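/- Let $q\ge 1$, let $\|\cdot\|$ be a norm on $\mathbb{R}^n$ (also its induced matrix norm), let $\langle\cdot,\cdot\rangle$ be the standard scalar product and $B(0,\delta)=\{d:\|d\|\le\delta\}$. For differentiable $f=(f_1,\dots,f_q):\mathbb{R}^n\to\mathbb{R}^q$ put $$\omega(x)=-\min_{\|d\|\le 1}\max_{i}\langle\nabla f_i(x),d\rangle ,$$ and call $x$ Pareto critical if for every $d\in\mathbb{R}^n$ there is an $i$ with $\langle\nabla f_i(x),d\rangle\ge 0$. **Algorithm (SMOP).** Input: $x_0\in\mathbb{R}^n$, $\Theta>0$, $\delta_{\max}>0$, $\delta_0\in(0,\delta_{\max})$, $\gamma_1,\eta_1\in(0,1)$, $\gamma_2=1/\gamma_1$, and $\alpha_k\in[0,1]$ $(k\ge 0)$. At iteration $k$ one is given (random) functions $\tilde f_{i}=\tilde f_{k,i}:\mathbb{R}^n\to\mathbb{R}$, vectors $g_i=g_{k,i}\in\mathbb{R}^n$ $(i=1,\dots,q)$ and a matrix $H_k\in\mathbb{R}^{n\times n}$. Put $$\tilde m_{k,i}(d)=\tilde f_{i}(x_k)+\langle g_i,d\rangle+\tfrac12\langle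 d,H_kd\rangle,\quad \tilde m_k=\max_i\tilde m_{k,i},\quad \tilde\phi=\max_i\tilde f_{i},$$ $$\omega_m(x_k)=-\min_{\|d\|\le1}\max_i\langle g_i,d\rangle,\quad \beta_k=1+\|H_k\| .$$ A step $d_k\in B(0,\delta_k)$ is chosen with $$\tilde m_k(0)-\tilde m_k(d_k)\ge\tfrac12\,\omega_m(x_k)\min\{\delta_k,\omega_m(x_k)/\beta_k\},$$ and $\rho_k=\dfrac{\tilde\phi(x_k)-\tilde\phi(x_k+d_k)}{\tilde m_k(0)-\tilde m_k(d_k)}$ is computed. If $\rho_k\ge\eta_1$ and $\omega_m(x_k)>\Theta\delta_k$, then $x_{k+1}=x_k+d_k$ and $\delta_{k+1}=\min\{\delta_{\max},\gamma_2\delta_k\}$; otherwise $x_{k+1}=x_k$ and $\delta_{k+1}=\gamma_1\delta_k$. **Probabilistic full linearity.** For constants $c_f,c_g\ge 0$ let $I_{k,i}$ be the event that for all $d\in B(0,\delta_k)$ $$|f_i(x_k+d)-\tilde m_{k,i}(d)|\le c_f\delta_k^2\quad\text{and}\quad\|\nabla f_i(x_k+d)-\nabla\tilde m_{k,i}(d)\|\le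 c_g\delta_k .$$ The models are $\alpha_k$ probabilistically $(c_f,c_g)$ fully linear if, almost surely, $P(I_{k,i}\mid\mathcal F_k)\ge\alpha_k$ for all $k$ and $i$, where $\mathcal F_k$ is the $\sigma$-algebra generated by $x_0,\dots,x_k$. **Theorem.** Let $(x_k)$ be generated by SMOP on a probability space, with $\alpha_k$ probabilistically $(c_f,c_g)$ fully linear models. Assume: 1. every $f_i$ is twice continuously differentiable and bounded below; 2. there are constants $c_h,c_b>0$ with $\|\nabla^2f_i(x)\|\le c_h$ for all $x\in\mathbb{R}^n$ and all $i$, and, almost surely, $\beta_k\le c_b$ for all $k$; 3. there are constants $L\ge0$, $c_a>0$ such that, almost surely, for all $k$ and $i$ the function $\tilde f_i$ is continuously differentiable, its gradient is $L$-Lipschitz, and $\|\nabla\tilde f_i(x_k)-g_i\|\le c_a\delta_k$; 4. $\sum_{k=0}^\infty(1-\alpha_k^q)<\infty$; 5. $\Theta\ge\max\{c_b,\,5c_f,\,4c_e/\eta_1\}$, where $c_e=c_f+L+c_g+c_a+c_h/2$; 6. almost surely, the sequence $(x_k)$ is bounded. Then, almost surely, $\lim_{k\to\infty}\omega(x_k)=0$.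 Consequently, almost surely, every accumulation point of $(x_k)$ is Pareto critical for $f$. -/

import Mathlib

open MeasureTheory ProbabilityTheory Filter Topology

noncomputable section

namespace SMOP

/-- The space `ℝⁿ` with its standard scalar product, which defines gradients and the pairings
`⟨∇f, d⟩`. All lengths are measured in a norm `N` that is a separate parameter. -/
abbrev Space (n : ℕ) : Type := EuclideanSpace ℝ (Fin n)

variable {n q : ℕ}

/-- The norm of a linear map of `ℝⁿ` induced by the vector norm `N`. -/
def inducedNorm (N : Seminorm ℝ (Space n)) (A : Space n →L[ℝ] Space n) : ℝ :=
  sSup ((fun d => N (A d)) '' {d | N d ≤ 1})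

/-- The Hessian of `f` at `x`, as the derivative of the gradient. -/
def hessian (f : Space n → ℝ) (x : Space n) : Space n →L[ℝ] Space n :=
  fderiv ℝ (gradient f) x

/-- `- min_{N d ≤ 1} max_i ⟨v i, d⟩`. -/
def marginalOf (N : Seminorm ℝ (Space n)) (v : Fin q → Space n) : ℝ :=
  -sInf ((fun d => ⨆ i, inner ℝ (v i) d) '' {d | N d ≤ 1})

/-- The (true) marginal function `ω(x)` of the objective `f = (f_1, …, f_q)`. -/
def marginal (N : Seminorm ℝ (Space n)) (f : Fin q → Space n → ℝ) (x : Space n) : ℝ :=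
  marginalOf N fun i => gradient (f i) x

/-- `x` is Pareto critical for `f`: no direction is a strict descent direction for every `f_i`. -/
def ParetoCritical (f : Fin q → Space n → ℝ) (x : Space n) : Prop :=
  ∀ d : Space n, ∃ i, 0 ≤ inner ℝ (gradient (f i) x) d

/-- What is computed at one iteration: the approximate objectives `f̃_i`, the approximate gradients
`g_i` at the current iterate, and the Hessian approximation `H`. -/
structure Approx (n q : ℕ) where
  fApp : Fin q → Space n → ℝ
  g : Fin q → Space n
  H : Space n →L[ℝ] Space n

namespace Approx

/-- The component model `m̃_i(d) = f̃_i(x) + ⟨g_i, d⟩ + ½ ⟨d, H d⟩` at the iterate `x`. -/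
def compModel (M : Approx n q) (x : Space n) (i : Fin q) (d : Space n) : ℝ :=
  M.fApp i x + inner ℝ (M.g i) d + 1 / 2 * inner ℝ d (M.H d)

/-- The model `m̃(d) = max_i m̃_i(d)`. -/
def model (M : Approx n q) (x d : Space n) : ℝ := ⨆ i, M.compModel x i d

/-- `φ̃ = max_i f̃_i`. -/
def phiApp (M : Approx n q) (x : Space n) : ℝ := ⨆ i, M.fApp i x

/-- The approximate marginal function `ω_m` at the current iterate. -/
def marginalApp (N : Seminorm ℝ (Space n)) (M : Approx n q) : ℝ := marginalOf N M.g

/-- `β = 1 + ‖H‖`. -/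
def beta (N : Seminorm ℝ (Space n)) (M : Approx n q) : ℝ := 1 + inducedNorm N M.H

/-- The ratio `ρ` of the reduction of `φ̃` to the reduction of the model for the step `d`. -/
def rho (M : Approx n q) (x d : Space n) : ℝ :=
  (M.phiApp x - M.phiApp (x + d)) / (M.model x 0 - M.model x d)

/-- The `i`-th component model is a `(c_f, c_g)` fully linear model of `f` on `B(x, δ)`. -/
def FullyLinear (N : Seminorm ℝ (Space n)) (cf cg : ℝ) (f : Space n → ℝ)
    (M : Approx n q) (i : Fin q) (x : Space n) (δ : ℝ) : Prop :=
  ∀ d : Space n, N d ≤ δ →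
    |f (x + d) - M.compModel x i d| ≤ cf * δ ^ 2 ∧
    N (gradient f (x + d) - gradient (M.compModel x i) d) ≤ cg * δ

end Approx

/-- The iteration from `(x, δ)` with the trial step `d` is successful. -/
def Successful (N : Seminorm ℝ (Space n)) (Θ η₁ : ℝ) (M : Approx n q) (x d : Space n)
    (δ : ℝ) : Prop :=
  η₁ ≤ M.rho x d ∧ Θ * δ < M.marginalApp N

/-- `x`, `δ`, `d` are the iterates, radii and trial steps of one run of the algorithm that uses
the approximations `M k` at iteration `k`; here `γ₂ = 1 / γ₁`. -/
structure IsRun (N : Seminorm ℝ (Space n)) (Θ δmax γ₁ η₁ : ℝ) (x₀ : Space n) (δ₀ : ℝ)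
    (M : ℕ → Approx n q) (x d : ℕ → Space n) (δ : ℕ → ℝ) : Prop where
  x_zero : x 0 = x₀
  δ_zero : δ 0 = δ₀
  step_le : ∀ k, N (d k) ≤ δ k
  sufficient_decrease : ∀ k,
    1 / 2 * (M k).marginalApp N * min (δ k) ((M k).marginalApp N / (M k).beta N) ≤
      (M k).model (x k) 0 - (M k).model (x k) (d k)
  accept : ∀ k, Successful N Θ η₁ (M k) (x k) (d k) (δ k) →
    x (k + 1) = x k + d k ∧ δ (k + 1) = min δmax (1 / γ₁ * δ k)
  reject : ∀ k, ¬ Successful N Θ η₁ (M k) (x k) (d k) (δ k) →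
    x (k + 1) = x k ∧ δ (k + 1) = γ₁ * δ k

variable {Ω : Type*}

/-- The σ-algebra generated by `x_0, …, x_k`. -/
abbrev history (x : ℕ → Ω → Space n) (k : ℕ) : MeasurableSpace Ω :=
  ⨆ j : ℕ, ⨆ _ : j ≤ k, MeasurableSpace.comap (x j) inferInstance

/-- The event `I_{k,i}` that the `i`-th component model of iteration `k` is fully linear. -/
def flEvent (N : Seminorm ℝ (Space n)) (cf cg : ℝ) (f : Fin q → Space n → ℝ)
    (M : ℕ → Ω → Approx n q) (x : ℕ → Ω → Space n) (δ : ℕ → Ω → ℝ) (k : ℕ) (i : Fin q) : Set Ω :=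
  {v | (M k v).FullyLinear N cf cg (f i) i (x k v) (δ k v)}

/-- The models are `α_k` probabilistically `(c_f, c_g)` fully linear: the `I_{k,i}` are events and
`P(I_{k,i} | x_0, …, x_k) ≥ α_k` almost surely. -/
def ProbFullyLinear [MeasurableSpace Ω] (P : Measure Ω) (N : Seminorm ℝ (Space n)) (cf cg : ℝ)
    (f : Fin q → Space n → ℝ) (M : ℕ → Ω → Approx n q) (x : ℕ → Ω → Space n)
    (δ : ℕ → Ω → ℝ) (α : ℕ → ℝ) : Prop :=
  ∀ k i, MeasurableSet (flEvent N cf cg f M x δ k i) ∧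
    ∀ᵐ v ∂P, α k ≤ (P⟦flEvent N cf cg f M x δ k i | history x k⟧) v

end SMOP

end

/-! Almost surely only finitely many iterations use a model that is not fully linear: integrating
out the conditioning bounds the failure probability of each component by `1 - α k ≤ 1 - α k ^ q`,
and Borel–Cantelli applies (`ProbFullyLinear.eventually_fullyLinear`). No independence is needed.

The rest is deterministic, on a tail of one sample path (`tendsto_zero_of_trustRegion`). With φ =
max f_i, a successful step lowers φ by at least ω_m δ / 10, which exceeds Θ δ² / 10. Hence δ² plus a
multiple of φ is a decreasing potential, and δ → 0. Such a step raises ω by at most O(δ), so it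
raises ω² by at most O(ω_m δ), which the decrease of φ again pays for. Thus ω² plus a multiple of φ
also decreases, and ω converges along the whole sequence. If its limit were positive, ω_m would stay
away from zero while δ → 0; every late step would then succeed and the radius could no longer
shrink, a contradiction.

Pareto criticality of accumulation points follows from the continuity of ω. -/

namespace SMOP

/-! ### Deterministic trust-region sequences -/

/-- An antitone potential `u + A φ` with `u` nonnegative and `φ` bounded below converges. -/
theorem exists_tendsto_of_antitone_add {φ u : ℕ → ℝ} {A b : ℝ} (hA : 0 ≤ A)
    (hb : ∀ k, b ≤ φ k) (hu : ∀ k, 0 ≤ u k) (hanti : Antitone fun k => u k + A * φ k) :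
    ∃ l, Tendsto (fun k => u k + A * φ k) atTop (𝓝 l) := by
  refine ⟨_, tendsto_atTop_ciInf hanti ⟨A * b, ?_⟩⟩
  rintro _ ⟨k, rfl⟩
  have := mul_le_mul_of_nonneg_left (hb k) hA
  have := hu k
  simp only
  linarith

/-- Real sequences that behave like the radii, values and criticality measures of a trust-region
method: the criticality measure tends to zero. -/
theorem tendsto_zero_of_trustRegion {δ φ W w : ℕ → ℝ} {S : ℕ → Prop}
    {δmax γ Θ b c l μ : ℝ} (hδmax : 0 < δmax) (hγ : 0 < γ) (hγ1 : γ < 1) (hΘ : 0 < Θ)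
    (hc : 0 ≤ c) (hl : 0 ≤ l) (hμ : 0 < μ) (hδ : ∀ k, 0 < δ k) (hb : ∀ k, b ≤ φ k)
    (hW : ∀ k, 0 ≤ W k)
    (hacc : ∀ k, S k → δ (k + 1) = min δmax (1 / γ * δ k))
    (hrej : ∀ k, ¬ S k → δ (k + 1) = γ * δ k ∧ W (k + 1) = W k ∧ φ (k + 1) = φ k)
    (hS : ∀ k, S k → Θ * δ k < w k)
    (hdec : ∀ k, S k → w k * δ k / 10 ≤ φ k - φ (k + 1))
    (hlip : ∀ k, S k → W (k + 1) ≤ W k + l * δ k)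
    (hWw : ∀ k, |W k - w k| ≤ c * δ k)
    (hsucc : ∀ k, δ k < μ * w k → S k) :
    Tendsto W atTop (𝓝 0) := by
  have hφ : Antitone φ := by
    refine antitone_nat_of_succ_le fun k => ?_
    by_cases h : S k
    · have h1 := hdec k h
      have h2 : 0 < w k := (mul_pos hΘ (hδ k)).trans (hS k h)
      have := mul_pos h2 (hδ k)
      linarith
    · exact (hrej k h).2.2.le
  have hdecδ : ∀ k, S k → Θ * δ k ^ 2 ≤ 10 * (φ k - φ (k + 1)) := fun k h => by
    have h1 := hdec k h
    have h2 := mul_le_mul_of_nonneg_right (hS k h).le (hδ k).le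
    nlinarith
  have hδ0 : Tendsto δ atTop (𝓝 0) := by
    -- With this weight the decrease of `φ` pays for the enlarged square `(δ k / γ) ^ 2` after a
    -- success; a rejection loses exactly `(1 - γ ^ 2) * δ k ^ 2`.
    set A : ℝ := 10 / (Θ * γ ^ 2) with hAdef
    have hA : 0 ≤ A := by positivity
    have hstep : ∀ k, δ (k + 1) ^ 2 + A * φ (k + 1) + (1 - γ ^ 2) * δ k ^ 2 ≤
        δ k ^ 2 + A * φ k := fun k => by
      by_cases h : S k
      · have h1 : δ (k + 1) ^ 2 ≤ (1 / γ * δ k) ^ 2 := by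
          refine pow_le_pow_left₀ (hδ _).le ?_ 2
          rw [hacc k h]
          exact min_le_right _ _
        have h2 : (1 / γ * δ k) ^ 2 ≤ A * (φ k - φ (k + 1)) := by
          have h3 := mul_le_mul_of_nonneg_left (hdecδ k h)
            (show 0 ≤ 1 / (Θ * γ ^ 2) by positivity)
          calc (1 / γ * δ k) ^ 2 = 1 / (Θ * γ ^ 2) * (Θ * δ k ^ 2) := by field_simp
            _ ≤ _ := h3
            _ = _ := by rw [hAdef]; ring
        have : 0 ≤ γ ^ 2 * δ k ^ 2 := by positivity
        linarith
      · rw [(hrej k h).1, (hrej k h).2.2]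
        apply le_of_eq
        ring
    have hγ2 : 0 < 1 - γ ^ 2 := by nlinarith
    obtain ⟨L, hL⟩ := exists_tendsto_of_antitone_add (u := fun k => δ k ^ 2) hA hb
      (fun k => sq_nonneg _) (antitone_nat_of_succ_le fun k => by
        have := hstep k
        have : 0 ≤ (1 - γ ^ 2) * δ k ^ 2 := by positivity
        linarith)
    -- Consecutive differences of the convergent potential vanish, and they dominate `(1 - γ ^ 2) *
    -- δ k ^ 2`.
    have hdiff := (hL.sub (hL.comp (tendsto_add_atTop_nat 1))).div_const (1 - γ ^ 2)
    simp only [sub_self, zero_div, Function.comp_def] at hdiff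
    have hsq : Tendsto (fun k => δ k ^ 2) atTop (𝓝 0) := by
      refine squeeze_zero (fun k => sq_nonneg _) (fun k => ?_) hdiff
      rw [le_div_iff₀ hγ2]
      linarith [hstep k]
    have := hsq.sqrt
    simpa [Real.sqrt_sq (hδ _).le] using this
  obtain ⟨p, hp⟩ : ∃ p, Tendsto φ atTop (𝓝 p) :=
    ⟨_, tendsto_atTop_ciInf hφ ⟨b, by rintro _ ⟨k, rfl⟩; exact hb k⟩⟩
  -- Squaring is essential: an increment `l * δ k` of `W` is not controlled by `w k * δ k` when `w
  -- k` is small, but the increment of `W ^ 2` carries the missing factor `w k`.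
  obtain ⟨r, hr⟩ : ∃ r, Tendsto (fun k => W k ^ 2) atTop (𝓝 r) := by
    set B : ℝ := 10 * (l * (2 + (2 * c + l) / Θ)) with hB
    obtain ⟨L, hL⟩ := exists_tendsto_of_antitone_add (A := B) (u := fun k => W k ^ 2)
      (by positivity) hb (fun k => sq_nonneg _) (antitone_nat_of_succ_le fun k => by
        by_cases h : S k
        · have h1 : W (k + 1) ^ 2 ≤ (W k + l * δ k) ^ 2 :=
            pow_le_pow_left₀ (hW _) (hlip k h) 2
          have h2 : W k ≤ w k + c * δ k := by linarith [(abs_le.1 (hWw k)).2]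
          have h3 : δ k ≤ w k / Θ := by
            rw [le_div_iff₀ hΘ]
            linarith [hS k h]
          have hlδ : 0 ≤ l * δ k := mul_nonneg hl (hδ k).le
          have h4 : (2 * c + l) * δ k ≤ (2 * c + l) * (w k / Θ) :=
            mul_le_mul_of_nonneg_left h3 (by positivity)
          have h5 : l * δ k * (2 * W k + l * δ k) ≤ l * δ k * (w k * (2 + (2 * c + l) / Θ)) := by
            refine mul_le_mul_of_nonneg_left ?_ hlδ
            have : w k * (2 + (2 * c + l) / Θ) = 2 * w k + (2 * c + l) * (w k / Θ) := by ring
            linarith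
          have h6 : l * δ k * (w k * (2 + (2 * c + l) / Θ)) = B * (w k * δ k / 10) := by
            rw [hB]; ring
          have h7 : B * (w k * δ k / 10) ≤ B * (φ k - φ (k + 1)) :=
            mul_le_mul_of_nonneg_left (hdec k h) (by positivity)
          nlinarith
        · rw [(hrej k h).2.1, (hrej k h).2.2])
    refine ⟨L - B * p, ?_⟩
    simpa using hL.sub (hp.const_mul B)
  have hWs : Tendsto W atTop (𝓝 √r) := by
    simpa [Real.sqrt_sq (hW _)] using hr.sqrt
  suffices h : √r = 0 by rwa [h] at hWs
  by_contra hne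
  have hpos : 0 < √r := lt_of_le_of_ne (Real.sqrt_nonneg _) (Ne.symm hne)
  have hev1 : ∀ᶠ k in atTop, √r / 2 < W k := hWs.eventually (lt_mem_nhds (by linarith))
  -- This threshold solves `δ < μ * (√r / 2 - c * δ)`, whose right side is below `μ * w k`.
  have hev2 : ∀ᶠ k in atTop, δ k < √r / 2 * (μ / (1 + μ * c)) :=
    hδ0.eventually (gt_mem_nhds (by positivity))
  -- Below `δmax`, the cap cannot make the radius decrease after a success.
  have hev3 : ∀ᶠ k in atTop, δ k < δmax := hδ0.eventually (gt_mem_nhds hδmax)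
  obtain ⟨K, hK⟩ := eventually_atTop.1 (hev1.and (hev2.and hev3))
  have hmono : ∀ k, K ≤ k → δ K ≤ δ k := fun k hk => by
    induction k, hk using Nat.le_induction with
    | base => exact le_rfl
    | succ k hk ih =>
      obtain ⟨h1, h2, h3⟩ := hK k hk
      have hs : S k := by
        refine hsucc k ?_
        have h4 := (abs_le.1 (hWw k)).2
        have h5 : δ k * (1 + μ * c) < √r / 2 * μ := by
          rw [← lt_div_iff₀ (by positivity), mul_div_assoc]
          exact h2
        have h6 : μ * (√r / 2 - c * δ k) ≤ μ * w k :=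
          mul_le_mul_of_nonneg_left (by linarith) hμ.le
        nlinarith
      rw [hacc k hs]
      refine ih.trans (le_min h3.le ?_)
      have : 1 ≤ 1 / γ := by rw [le_div_iff₀ hγ]; linarith
      exact le_mul_of_one_le_left (hδ k).le this
  exact absurd (hδ K) (not_lt.2 (ge_of_tendsto hδ0 (eventually_atTop.2 ⟨K, hmono⟩)))

/-! ### Norm comparison, marginal functions and Taylor estimates -/

variable {n q : ℕ}

/-- A norm on `ℝⁿ` is equivalent to the Euclidean norm. -/
theorem exists_norm_comparison (N : Seminorm ℝ (Space n)) (hN : ∀ y, N y = 0 → y = 0) :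
    ∃ a : ℝ, 0 < a ∧ (∀ y, N y ≤ a * ‖y‖) ∧ ∀ y, ‖y‖ ≤ a * N y := by
  have hcont : Continuous N := continuousOn_univ.1 (N.convexOn.continuousOn isOpen_univ)
  obtain ⟨C, hC, hNC⟩ := Seminorm.bound_of_continuous_normedSpace N hcont
  obtain ⟨c, hc, hcN⟩ : ∃ c > 0, ∀ y : Space n, ‖y‖ = 1 → c ≤ N y := by
    -- The sphere is empty when `n = 0`.
    rcases (Metric.sphere (0 : Space n) 1).eq_empty_or_nonempty with h | h
    · refine ⟨1, one_pos, fun y hy => ?_⟩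
      exact absurd (show y ∈ Metric.sphere (0 : Space n) 1 by simpa using hy) (by simp [h])
    · obtain ⟨z, hz, hmin⟩ := (isCompact_sphere (0 : Space n) 1).exists_isMinOn h hcont.continuousOn
      refine ⟨N z, lt_of_le_of_ne (apply_nonneg N z) fun h0 => ?_, fun y hy => hmin (by simpa using hy)⟩
      have : z = 0 := hN z h0.symm
      simp [this] at hz
  refine ⟨max C (1 / c), lt_max_of_lt_left hC, fun y => ?_, fun y => ?_⟩
  · exact (hNC y).trans (mul_le_mul_of_nonneg_right (le_max_left _ _) (norm_nonneg y))
  · refine le_trans ?_ (mul_le_mul_of_nonneg_right (le_max_right _ _) (apply_nonneg N y))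
    by_cases hy : y = 0
    · simp [hy]
    have hy' : 0 < ‖y‖ := norm_pos_iff.2 hy
    have h1 := hcN (‖y‖⁻¹ • y) (by rw [norm_smul, norm_inv, norm_norm, inv_mul_cancel₀ hy'.ne'])
    rw [map_smul_eq_mul, norm_inv, norm_norm, inv_mul_eq_div, le_div_iff₀ hy'] at h1
    rw [one_div, inv_mul_eq_div, le_div_iff₀ hc]
    linarith

section Comparison

variable {N : Seminorm ℝ (Space n)} {a : ℝ}

theorem abs_inner_le (ha : 0 < a) (h2 : ∀ y, ‖y‖ ≤ a * N y) (y z : Space n) :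
    |inner ℝ y z| ≤ a ^ 2 * N y * N z := by
  have := mul_le_mul (h2 y) (h2 z) (norm_nonneg z) (mul_nonneg ha.le (apply_nonneg N y))
  calc |inner ℝ y z| ≤ ‖y‖ * ‖z‖ := abs_real_inner_le_norm y z
    _ ≤ _ := this
    _ = _ := by ring

theorem inducedNorm_nonneg (N : Seminorm ℝ (Space n)) (A : Space n →L[ℝ] Space n) :
    0 ≤ inducedNorm N A :=
  Real.sSup_nonneg (by rintro _ ⟨d, -, rfl⟩; exact apply_nonneg N _)

/-- Boundedness of the image has to be checked first, since `sSup` of an unbounded set is `0` by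
default. -/
theorem apply_le_inducedNorm_mul (ha : 0 < a) (h1 : ∀ y, N y ≤ a * ‖y‖)
    (h2 : ∀ y, ‖y‖ ≤ a * N y) (A : Space n →L[ℝ] Space n) (y : Space n) :
    N (A y) ≤ inducedNorm N A * N y := by
  have hbdd : BddAbove ((fun d => N (A d)) '' {d | N d ≤ 1}) := by
    refine ⟨a * (‖A‖ * (a * 1)), ?_⟩
    rintro _ ⟨d, hd, rfl⟩
    refine (h1 _).trans (mul_le_mul_of_nonneg_left ((A.le_opNorm d).trans ?_) ha.le)
    refine mul_le_mul_of_nonneg_left ((h2 d).trans ?_) (norm_nonneg A)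
    exact mul_le_mul_of_nonneg_left hd ha.le
  rcases (apply_nonneg N y).eq_or_lt with h0 | hpos
  · have hy : y = 0 := by
      have := h2 y
      rw [← h0, mul_zero] at this
      exact norm_le_zero_iff.1 this
    simp [hy]
  · have h : N (A ((N y)⁻¹ • y)) ≤ inducedNorm N A := by
      refine le_csSup hbdd ⟨(N y)⁻¹ • y, ?_, rfl⟩
      simp [map_smul_eq_mul, abs_of_pos hpos, inv_mul_cancel₀ hpos.ne']
    rw [map_smul, map_smul_eq_mul, norm_inv, Real.norm_eq_abs, abs_of_pos hpos, inv_mul_eq_div,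
      div_le_iff₀ hpos] at h
    exact h

theorem abs_ciSup_sub_ciSup_le {ι : Type*} [Finite ι] [Nonempty ι] {u v : ι → ℝ} {ε : ℝ}
    (h : ∀ i, |u i - v i| ≤ ε) : |(⨆ i, u i) - ⨆ i, v i| ≤ ε := by
  have key : ∀ u v : ι → ℝ, (∀ i, |u i - v i| ≤ ε) → (⨆ i, u i) ≤ (⨆ i, v i) + ε :=
    fun u v h => ciSup_le fun i => by
      have := le_ciSup (Set.finite_range v).bddAbove i
      linarith [(abs_le.1 (h i)).2]
  rw [abs_le]
  constructor
  · linarith [key v u fun i => by rw [abs_sub_comm]; exact h i]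
  · linarith [key u v h]

/-- Any single index bounds the maximum from below. Without this, the `sInf` in `marginalOf` could
take its default value `0`. -/
theorem bddBelow_marginal_image (hq : 0 < q) (ha : 0 < a) (h2 : ∀ y, ‖y‖ ≤ a * N y)
    (v : Fin q → Space n) :
    BddBelow ((fun d => ⨆ i, inner ℝ (v i) d) '' {d | N d ≤ 1}) := by
  refine ⟨-(a ^ 2 * N (v ⟨0, hq⟩) * 1), ?_⟩
  rintro _ ⟨d, hd, rfl⟩
  refine le_trans ?_ (le_ciSup (Set.finite_range fun i => inner ℝ (v i) d).bddAbove ⟨0, hq⟩)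
  have h := (abs_le.1 (abs_inner_le ha h2 (v ⟨0, hq⟩) d)).1
  have : a ^ 2 * N (v ⟨0, hq⟩) * N d ≤ a ^ 2 * N (v ⟨0, hq⟩) * 1 :=
    mul_le_mul_of_nonneg_left hd (mul_nonneg (sq_nonneg a) (apply_nonneg N _))
  linarith

theorem neg_marginalOf_le (hq : 0 < q) (ha : 0 < a) (h2 : ∀ y, ‖y‖ ≤ a * N y)
    (v : Fin q → Space n) {d : Space n} (hd : N d ≤ 1) :
    -marginalOf N v ≤ ⨆ i, inner ℝ (v i) d := by
  rw [marginalOf, neg_neg]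
  exact csInf_le (bddBelow_marginal_image hq ha h2 v) ⟨d, hd, rfl⟩

theorem marginalOf_nonneg (hq : 0 < q) (ha : 0 < a) (h2 : ∀ y, ‖y‖ ≤ a * N y)
    (v : Fin q → Space n) : 0 ≤ marginalOf N v := by
  have := neg_marginalOf_le hq ha h2 v (d := 0) (by simp)
  simp only [inner_zero_right, Real.iSup_const_zero] at this
  linarith

/-- Maxima and minima do not amplify uniform errors. This serves twice: to compare ω with ω_m, and
to make ω Lipschitz. -/
theorem abs_marginalOf_sub_le (hq : 0 < q) (ha : 0 < a) (h2 : ∀ y, ‖y‖ ≤ a * N y)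
    {v w : Fin q → Space n} {ε : ℝ} (h : ∀ i, N (v i - w i) ≤ ε) :
    |marginalOf N v - marginalOf N w| ≤ a ^ 2 * ε := by
  have : Nonempty (Fin q) := ⟨⟨0, hq⟩⟩
  have key : ∀ v w : Fin q → Space n, (∀ i, N (v i - w i) ≤ ε) →
      marginalOf N v ≤ marginalOf N w + a ^ 2 * ε := fun v w h => by
    suffices -marginalOf N v ≥ -marginalOf N w - a ^ 2 * ε by linarith
    conv_lhs => rw [marginalOf, neg_neg]
    refine le_csInf ⟨_, 0, by simp, rfl⟩ ?_
    rintro _ ⟨d, hd, rfl⟩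
    have h3 : |(⨆ i, inner ℝ (v i) d) - ⨆ i, inner ℝ (w i) d| ≤ a ^ 2 * ε :=
      abs_ciSup_sub_ciSup_le fun i => by
        rw [← inner_sub_left]
        refine (abs_inner_le ha h2 _ _).trans ?_
        have h4 : 0 ≤ N (v i - w i) := apply_nonneg N _
        have h5 : a ^ 2 * N (v i - w i) * N d ≤ a ^ 2 * N (v i - w i) * 1 :=
          mul_le_mul_of_nonneg_left hd (by positivity)
        have h6 := mul_le_mul_of_nonneg_left (h i) (sq_nonneg a)
        linarith
    have := neg_marginalOf_le hq ha h2 w hd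
    have := (abs_le.1 h3).1
    simp only
    linarith
  rw [abs_le]
  constructor
  · linarith [key w v fun i => by rw [map_sub_rev]; exact h i]
  · linarith [key v w h]

/-- A zero of the marginal function is a Pareto critical point. -/
theorem paretoCritical_of_marginal_eq_zero (hq : 0 < q) (ha : 0 < a)
    (h2 : ∀ y, ‖y‖ ≤ a * N y) {f : Fin q → Space n → ℝ} {x : Space n}
    (h : marginal N f x = 0) : ParetoCritical f x := by
  have : Nonempty (Fin q) := ⟨⟨0, hq⟩⟩
  intro d
  -- Scaling by `1 + N d` instead of `N d` also covers `d = 0`.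
  have ht : 0 < (1 + N d)⁻¹ := inv_pos.2 (by linarith [apply_nonneg N d])
  have hd : N ((1 + N d)⁻¹ • d) ≤ 1 := by
    rw [map_smul_eq_mul, Real.norm_eq_abs, abs_of_pos ht, inv_mul_le_iff₀ (inv_pos.1 ht)]
    linarith
  have h3 := neg_marginalOf_le hq ha h2 (fun i => gradient (f i) x) hd
  rw [← marginal, h, neg_zero] at h3
  obtain ⟨i, hi⟩ := exists_eq_ciSup_of_finite
    (f := fun i => inner ℝ (gradient (f i) x) ((1 + N d)⁻¹ • d))
  refine ⟨i, ?_⟩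
  rw [← hi, inner_smul_right] at h3
  exact nonneg_of_mul_nonneg_right h3 ht

/-- First-order Taylor estimate for a function whose gradient is Lipschitz in the norm `N`. -/
theorem abs_sub_sub_inner_gradient_le (ha : 0 < a) (h2 : ∀ y, ‖y‖ ≤ a * N y) {F : Space n → ℝ}
    (hF : ContDiff ℝ 1 F) {L : ℝ} (hL : 0 ≤ L)
    (hlip : ∀ y z, N (gradient F y - gradient F z) ≤ L * N (y - z)) (x d : Space n) :
    |F (x + d) - F x - inner ℝ (gradient F x) d| ≤ a ^ 2 * L * N d ^ 2 := by
  have hmem : ∀ y ∈ segment ℝ x (x + d), ‖fderiv ℝ F y - fderiv ℝ F x‖ ≤ a * (L * N d) := by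
    intro y hy
    rw [← toDual_gradient, ← toDual_gradient, ← map_sub, LinearIsometryEquiv.norm_map]
    refine (h2 _).trans (mul_le_mul_of_nonneg_left ((hlip y x).trans ?_) ha.le)
    refine mul_le_mul_of_nonneg_left ?_ hL
    rw [segment_eq_image'] at hy
    obtain ⟨t, ht, rfl⟩ := hy
    simp only [add_sub_cancel_left, map_smul_eq_mul, Real.norm_eq_abs, abs_of_nonneg ht.1]
    exact mul_le_of_le_one_left (apply_nonneg N d) ht.2
  have h := (convex_segment x (x + d)).norm_image_sub_le_of_norm_fderiv_le'
    (fun y _ => (hF.differentiable one_ne_zero) y) hmem (left_mem_segment ℝ x (x + d))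
    (right_mem_segment ℝ x (x + d))
  rw [add_sub_cancel_left, Real.norm_eq_abs, ← toDual_gradient,
    InnerProductSpace.toDual_apply_apply] at h
  refine h.trans ?_
  have hLN : 0 ≤ L * N d := mul_nonneg hL (apply_nonneg N d)
  calc a * (L * N d) * ‖d‖ ≤ a * (L * N d) * (a * N d) :=
        mul_le_mul_of_nonneg_left (h2 d) (by positivity)
    _ = _ := by ring

theorem differentiable_gradient {F : Space n → ℝ} (hF : ContDiff ℝ 2 F) :
    Differentiable ℝ (gradient F) :=
  ((InnerProductSpace.toDual ℝ (Space n)).symm.toContinuousLinearEquiv.differentiable).comp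
    ((hF.fderiv_right (m := 1) (by norm_num)).differentiable one_ne_zero)

/-- A bound on the Hessians makes the gradient Lipschitz. -/
theorem gradient_sub_le_of_hessian_le (ha : 0 < a) (h1 : ∀ y, N y ≤ a * ‖y‖)
    (h2 : ∀ y, ‖y‖ ≤ a * N y) {F : Space n → ℝ} (hF : ContDiff ℝ 2 F) {c : ℝ}
    (hc : ∀ y, inducedNorm N (hessian F y) ≤ c) (y z : Space n) :
    N (gradient F y - gradient F z) ≤ a ^ 4 * c * N (y - z) := by
  have hc0 : 0 ≤ c := (inducedNorm_nonneg N _).trans (hc 0)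
  have hb : ∀ w ∈ (Set.univ : Set (Space n)), ‖fderiv ℝ (gradient F) w‖ ≤ a ^ 2 * c := by
    intro w _
    refine ContinuousLinearMap.opNorm_le_bound _ (by positivity) fun e => ?_
    calc ‖fderiv ℝ (gradient F) w e‖ ≤ a * N (hessian F w e) := h2 _
      _ ≤ a * (c * (a * ‖e‖)) := by
        refine mul_le_mul_of_nonneg_left ?_ ha.le
        exact (apply_le_inducedNorm_mul ha h1 h2 _ e).trans
          (mul_le_mul (hc w) (h1 e) (apply_nonneg N e) hc0)
      _ = _ := by ring
  have h := convex_univ.norm_image_sub_le_of_norm_fderiv_le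
    (fun w _ => differentiable_gradient hF w) hb (Set.mem_univ z) (Set.mem_univ y)
  calc N (gradient F y - gradient F z) ≤ a * ‖gradient F y - gradient F z‖ := h1 _
    _ ≤ a * (a ^ 2 * c * (a * N (y - z))) :=
      mul_le_mul_of_nonneg_left (h.trans (mul_le_mul_of_nonneg_left (h2 _) (by positivity))) ha.le
    _ = _ := by ring

end Comparison

/-! ### Estimates for a single iteration -/

namespace Approx

variable {N : Seminorm ℝ (Space n)} {a : ℝ}

theorem one_le_beta (N : Seminorm ℝ (Space n)) (M : Approx n q) : 1 ≤ M.beta N := by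
  have := inducedNorm_nonneg N M.H
  rw [beta]
  linarith

theorem compModel_zero (M : Approx n q) (x : Space n) (i : Fin q) :
    M.compModel x i 0 = M.fApp i x := by
  simp [compModel]

theorem model_zero (M : Approx n q) (x : Space n) : M.model x 0 = M.phiApp x := by
  simp [model, phiApp, compModel_zero]

/-- The quadratic term has zero derivative at the origin, whether or not `H` is symmetric. -/
theorem gradient_compModel_zero (M : Approx n q) (x : Space n) (i : Fin q) :
    gradient (M.compModel x i) 0 = M.g i := by
  refine HasGradientAt.gradient ?_
  rw [hasGradientAt_iff_hasFDerivAt]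
  have h1 : HasFDerivAt (fun d : Space n => inner ℝ (M.g i) d)
      (InnerProductSpace.toDual ℝ (Space n) (M.g i)) 0 :=
    (InnerProductSpace.toDual ℝ (Space n) (M.g i)).hasFDerivAt
  have h2 := (hasFDerivAt_id (𝕜 := ℝ) (0 : Space n)).inner ℝ (M.H.hasFDerivAt (x := 0))
  have h3 := (h1.const_add (M.fApp i x)).add (h2.const_mul (1 / 2))
  refine h3.congr_fderiv ?_
  ext e
  simp

theorem FullyLinear.abs_phi_sub_model_le (hq : 0 < q) {f : Fin q → Space n → ℝ} {M : Approx n q}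
    {cf cg δ : ℝ} {x d : Space n} (h : ∀ i, M.FullyLinear N cf cg (f i) i x δ) (hd : N d ≤ δ) :
    |(⨆ i, f i (x + d)) - M.model x d| ≤ cf * δ ^ 2 :=
  have : Nonempty (Fin q) := ⟨⟨0, hq⟩⟩
  abs_ciSup_sub_ciSup_le fun i => (h i d hd).1

theorem FullyLinear.abs_marginal_sub_le (hq : 0 < q) (ha : 0 < a) (h2 : ∀ y, ‖y‖ ≤ a * N y)
    {f : Fin q → Space n → ℝ} {M : Approx n q} {cf cg δ : ℝ} {x : Space n} (hδ : 0 < δ)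
    (h : ∀ i, M.FullyLinear N cf cg (f i) i x δ) :
    |marginal N f x - M.marginalApp N| ≤ a ^ 2 * (cg * δ) :=
  abs_marginalOf_sub_le hq ha h2 fun i => by
    have := (h i 0 (by simpa using hδ.le)).2
    rwa [add_zero, gradient_compModel_zero] at this

/-- The model approximates `φ̃` to second order. -/
theorem abs_phiApp_sub_model_le (hq : 0 < q) (ha : 0 < a) (h1 : ∀ y, N y ≤ a * ‖y‖)
    (h2 : ∀ y, ‖y‖ ≤ a * N y) {M : Approx n q} {x d : Space n} {δ L ca cb : ℝ}
    (hL : 0 ≤ L) (hcb : M.beta N ≤ cb) (hd : N d ≤ δ)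
    (happ : ∀ i, ContDiff ℝ 1 (M.fApp i) ∧
      (∀ y z, N (gradient (M.fApp i) y - gradient (M.fApp i) z) ≤ L * N (y - z)) ∧
      N (gradient (M.fApp i) x - M.g i) ≤ ca * δ) :
    |M.phiApp (x + d) - M.model x d| ≤ a ^ 2 * (L + ca + cb) * δ ^ 2 := by
  have : Nonempty (Fin q) := ⟨⟨0, hq⟩⟩
  refine abs_ciSup_sub_ciSup_le fun i => ?_
  obtain ⟨hC, hlip, hg⟩ := happ i
  have hNd : 0 ≤ N d := apply_nonneg N d
  have hδ : 0 ≤ δ := hNd.trans hd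
  have hcb0 : 0 ≤ cb := (zero_le_one.trans (M.one_le_beta N)).trans hcb
  have hsq : N d ^ 2 ≤ δ ^ 2 := pow_le_pow_left₀ hNd hd 2
  -- The error splits into the Taylor remainder of `fApp`, the gradient mismatch and the quadratic
  -- term.
  have e1 : |M.fApp i (x + d) - M.fApp i x - inner ℝ (gradient (M.fApp i) x) d| ≤
      a ^ 2 * L * δ ^ 2 :=
    (abs_sub_sub_inner_gradient_le ha h2 hC hL hlip x d).trans
      (mul_le_mul_of_nonneg_left hsq (by positivity))
  have e2 : |inner ℝ (gradient (M.fApp i) x - M.g i) d| ≤ a ^ 2 * ca * δ ^ 2 := by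
    have h3 := mul_le_mul hg hd hNd ((apply_nonneg N _).trans hg)
    calc _ ≤ a ^ 2 * N (gradient (M.fApp i) x - M.g i) * N d := abs_inner_le ha h2 _ _
      _ = a ^ 2 * (N (gradient (M.fApp i) x - M.g i) * N d) := by ring
      _ ≤ a ^ 2 * (ca * δ * δ) := mul_le_mul_of_nonneg_left h3 (sq_nonneg a)
      _ = _ := by ring
  have e3 : |inner ℝ d (M.H d)| ≤ a ^ 2 * cb * δ ^ 2 := by
    have h3 : N (M.H d) ≤ cb * N d := (apply_le_inducedNorm_mul ha h1 h2 _ d).trans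
      (mul_le_mul_of_nonneg_right (by rw [beta] at hcb; linarith) hNd)
    calc _ ≤ a ^ 2 * N d * N (M.H d) := abs_inner_le ha h2 _ _
      _ ≤ a ^ 2 * N d * (cb * N d) := mul_le_mul_of_nonneg_left h3 (by positivity)
      _ = a ^ 2 * cb * N d ^ 2 := by ring
      _ ≤ _ := mul_le_mul_of_nonneg_left hsq (by positivity)
  rw [inner_sub_left] at e2
  rw [abs_le] at e1 e2 e3 ⊢
  simp only [compModel]
  constructor <;> linarith [e1.1, e1.2, e2.1, e2.2, e3.1, e3.2]

end Approx

/-- An iteration whose radius is small relative to the approximate marginal is successful. -/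
theorem successful_of_radius_le {N : Seminorm ℝ (Space n)} {M : Approx n q} {x d : Space n}
    {δ Θ η₁ C : ℝ} (hδ : 0 < δ) (hη : η₁ < 1) (hw : 0 < M.marginalApp N)
    (hdec : 1 / 2 * M.marginalApp N * min δ (M.marginalApp N / M.beta N) ≤
      M.model x 0 - M.model x d)
    (happ : |M.phiApp (x + d) - M.model x d| ≤ C * δ ^ 2)
    (hβ : M.beta N * δ ≤ M.marginalApp N) (hΘ : Θ * δ < M.marginalApp N)
    (hC : 2 * C * δ ≤ (1 - η₁) * M.marginalApp N) : Successful N Θ η₁ M x d δ := by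
  refine ⟨?_, hΘ⟩
  have hβ0 : 0 < M.beta N := one_pos.trans_le (M.one_le_beta N)
  rw [min_eq_left ((le_div_iff₀ hβ0).2 (by linarith))] at hdec
  have hpos : 0 < M.model x 0 - M.model x d :=
    (mul_pos (mul_pos one_half_pos hw) hδ).trans_le hdec
  rw [Approx.rho, le_div_iff₀ hpos, ← Approx.model_zero]
  -- The model error is at most `C * δ ^ 2`, hence at most `1 - η₁` times the predicted reduction.
  have h1 := mul_le_mul_of_nonneg_right hC hδ.le
  have h2 := mul_le_mul_of_nonneg_left hdec (sub_nonneg.2 hη.le)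
  have h3 := (abs_le.1 happ).2
  nlinarith

/-- On a successful iteration with fully linear models the true objective decreases. -/
theorem decrease_of_successful (hq : 0 < q) {N : Seminorm ℝ (Space n)} {f : Fin q → Space n → ℝ}
    {M : Approx n q} {x d : Space n} {δ Θ η₁ cf cg : ℝ} (hδ : 0 < δ)
    (hs : Successful N Θ η₁ M x d δ) (hd : N d ≤ δ)
    (hdec : 1 / 2 * M.marginalApp N * min δ (M.marginalApp N / M.beta N) ≤
      M.model x 0 - M.model x d)
    (hfl : ∀ i, M.FullyLinear N cf cg (f i) i x δ) (hβ : M.beta N ≤ Θ) (hcf : 5 * cf ≤ Θ) :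
    M.marginalApp N * δ / 10 ≤ (⨆ i, f i x) - ⨆ i, f i (x + d) := by
  have hΘ := hs.2
  have hβ0 : 0 < M.beta N := one_pos.trans_le (M.one_le_beta N)
  have h4 := mul_le_mul_of_nonneg_right hβ hδ.le
  rw [min_eq_left ((le_div_iff₀ hβ0).2 (by linarith))] at hdec
  have h1 := Approx.FullyLinear.abs_phi_sub_model_le hq hfl hd
  have h2 := Approx.FullyLinear.abs_phi_sub_model_le hq hfl (d := 0) (by simpa using hδ.le)
  rw [add_zero] at h2
  -- The model falls by at least half of `marginalApp * δ`; the two model errors cost at most two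
  -- fifths of it, leaving one tenth.
  have h3 : 5 * cf * δ ^ 2 ≤ M.marginalApp N * δ := by
    have := mul_le_mul_of_nonneg_right hcf (sq_nonneg δ)
    have := mul_le_mul_of_nonneg_right hΘ.le hδ.le
    nlinarith
  linarith [(abs_le.1 h1).2, (abs_le.1 h2).1]

/-! ### Convergence along one sample path -/

section Path

variable {N : Seminorm ℝ (Space n)} {f : Fin q → Space n → ℝ}

theorem abs_marginal_sub_le (hq : 0 < q) {a ch : ℝ} (ha : 0 < a) (h1 : ∀ y, N y ≤ a * ‖y‖)
    (h2 : ∀ y, ‖y‖ ≤ a * N y) (hf : ∀ i, ContDiff ℝ 2 (f i))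
    (hess : ∀ i y, inducedNorm N (hessian (f i) y) ≤ ch) (y z : Space n) :
    |marginal N f y - marginal N f z| ≤ a ^ 6 * ch * N (y - z) :=
  (abs_marginalOf_sub_le hq ha h2 fun i =>
    gradient_sub_le_of_hessian_le ha h1 h2 (hf i) (hess i) y z).trans_eq (by ring)

theorem continuous_marginal (hq : 0 < q) (hN : ∀ y, N y = 0 → y = 0) {ch : ℝ} (hch : 0 ≤ ch)
    (hf : ∀ i, ContDiff ℝ 2 (f i)) (hess : ∀ i y, inducedNorm N (hessian (f i) y) ≤ ch) :
    Continuous (marginal N f) := by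
  obtain ⟨a, ha, h1, h2⟩ := exists_norm_comparison N hN
  refine (LipschitzWith.of_dist_le_mul (K := (a ^ 6 * ch * a).toNNReal) fun y z => ?_).continuous
  rw [Real.coe_toNNReal _ (by positivity), Real.dist_eq, dist_eq_norm]
  calc _ ≤ a ^ 6 * ch * N (y - z) := abs_marginal_sub_le hq ha h1 h2 hf hess y z
    _ ≤ a ^ 6 * ch * (a * ‖y - z‖) := mul_le_mul_of_nonneg_left (h1 _) (by positivity)
    _ = _ := by ring

variable {Θ δmax γ₁ η₁ δ₀ : ℝ} {x₀ : Space n} {M : ℕ → Approx n q} {x d : ℕ → Space n}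
  {δ : ℕ → ℝ}

theorem IsRun.radius_pos (h : IsRun N Θ δmax γ₁ η₁ x₀ δ₀ M x d δ) (hδmax : 0 < δmax)
    (hδ₀ : 0 < δ₀) (hγ₁ : 0 < γ₁) (k : ℕ) : 0 < δ k := by
  induction k with
  | zero => rwa [h.δ_zero]
  | succ k ih =>
    by_cases hs : Successful N Θ η₁ (M k) (x k) (d k) (δ k)
    · rw [(h.accept k hs).2]
      exact lt_min hδmax (by positivity)
    · rw [(h.reject k hs).2]
      positivity

/-- A run whose models are eventually fully linear drives the marginal function to zero. -/
theorem IsRun.tendsto_marginal (h : IsRun N Θ δmax γ₁ η₁ x₀ δ₀ M x d δ) (hq : 0 < q)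
    (hN : ∀ y, N y = 0 → y = 0) (hf : ∀ i, ContDiff ℝ 2 (f i))
    (hfb : ∀ i, BddBelow (Set.range (f i))) {ch : ℝ} (hch : 0 ≤ ch)
    (hess : ∀ i y, inducedNorm N (hessian (f i) y) ≤ ch) (hΘ : 0 < Θ) (hδmax : 0 < δmax)
    (hδ₀ : 0 < δ₀) (hγ₁ : γ₁ ∈ Set.Ioo (0 : ℝ) 1) (hη₁ : η₁ < 1) {cf cg cb L ca : ℝ}
    (hcg : 0 ≤ cg) (hcb : 0 ≤ cb) (hbeta : ∀ k, (M k).beta N ≤ cb) (hL : 0 ≤ L) (hca : 0 ≤ ca)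
    (happ : ∀ k i, ContDiff ℝ 1 ((M k).fApp i) ∧
      (∀ y z, N (gradient ((M k).fApp i) y - gradient ((M k).fApp i) z) ≤ L * N (y - z)) ∧
      N (gradient ((M k).fApp i) (x k) - (M k).g i) ≤ ca * δ k)
    (hcbΘ : cb ≤ Θ) (hcfΘ : 5 * cf ≤ Θ)
    (hfl : ∀ᶠ k in atTop, ∀ i, (M k).FullyLinear N cf cg (f i) i (x k) (δ k)) :
    Tendsto (fun k => marginal N f (x k)) atTop (𝓝 0) := by
  obtain ⟨a, ha, h1, h2⟩ := exists_norm_comparison N hN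
  obtain ⟨K, hK⟩ := eventually_atTop.1 hfl
  obtain ⟨b, hb⟩ := hfb ⟨0, hq⟩
  have hδ := h.radius_pos hδmax hδ₀ hγ₁.1
  have hη : 0 < 1 - η₁ := sub_pos.2 hη₁
  set C : ℝ := a ^ 2 * (L + ca + cb) with hC
  have hC0 : 0 ≤ C := by positivity
  rw [← tendsto_add_atTop_iff_nat K]
  -- The value of `μ` makes `δ < μ * w` yield both `Θ * δ < w` and `2 * C * δ ≤ (1 - η₁) * w`.
  refine tendsto_zero_of_trustRegion (δ := fun k => δ (k + K)) (φ := fun k => ⨆ i, f i (x (k + K)))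
    (w := fun k => (M (k + K)).marginalApp N)
    (S := fun k => Successful N Θ η₁ (M (k + K)) (x (k + K)) (d (k + K)) (δ (k + K)))
    (b := b) (c := a ^ 2 * cg) (l := a ^ 6 * ch) (μ := 1 / (Θ + 2 * C / (1 - η₁)))
    hδmax hγ₁.1 hγ₁.2 hΘ (by positivity) (by positivity) (by positivity) (fun k => hδ _)
    (fun k => ?_) (fun k => marginalOf_nonneg hq ha h2 _) (fun k hs => ?_) (fun k hs => ?_)
    (fun k hs => hs.2) (fun k hs => ?_) (fun k hs => ?_) (fun k => ?_) (fun k hk => ?_)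
  · exact (hb ⟨_, rfl⟩).trans
      (le_ciSup (Set.finite_range fun i => f i (x (k + K))).bddAbove ⟨0, hq⟩)
  · rw [Nat.add_right_comm]
    exact (h.accept _ hs).2
  · rw [Nat.add_right_comm, (h.reject _ hs).1]
    exact ⟨(h.reject _ hs).2, rfl, rfl⟩
  · rw [Nat.add_right_comm, (h.accept _ hs).1]
    exact decrease_of_successful hq (hδ _) hs (h.step_le _) (h.sufficient_decrease _)
      (hK _ (Nat.le_add_left K k)) ((hbeta _).trans hcbΘ) hcfΘ
  · rw [Nat.add_right_comm, (h.accept _ hs).1]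
    have h3 := abs_marginal_sub_le hq ha h1 h2 hf hess (x (k + K) + d (k + K)) (x (k + K))
    rw [add_sub_cancel_left] at h3
    have h4 : a ^ 6 * ch * N (d (k + K)) ≤ a ^ 6 * ch * δ (k + K) :=
      mul_le_mul_of_nonneg_left (h.step_le _) (by positivity)
    linarith [(abs_le.1 h3).2]
  · exact (Approx.FullyLinear.abs_marginal_sub_le hq ha h2 (hδ _)
      (hK _ (Nat.le_add_left K k))).trans_eq (by ring)
  · have hden : 0 < Θ + 2 * C / (1 - η₁) := by positivity
    have hδk := hδ (k + K)
    rw [one_div, inv_mul_eq_div, lt_div_iff₀ hden] at hk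
    have hCδ : 0 ≤ δ (k + K) * (2 * C / (1 - η₁)) := by positivity
    have hΘδ : 0 < Θ * δ (k + K) := mul_pos hΘ hδk
    have hw : Θ * δ (k + K) < (M (k + K)).marginalApp N := by linarith
    refine successful_of_radius_le (C := C) hδk hη₁ (hΘδ.trans hw) (h.sufficient_decrease _)
      (Approx.abs_phiApp_sub_model_le hq ha h1 h2 hL (hbeta _) (h.step_le _) (happ _))
      ?_ hw ?_
    · exact (mul_le_mul_of_nonneg_right ((hbeta _).trans hcbΘ) hδk.le).trans hw.le
    · have h5 : δ (k + K) * (2 * C / (1 - η₁)) ≤ (M (k + K)).marginalApp N := by linarith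
      rw [← mul_div_assoc, div_le_iff₀ hη] at h5
      linarith

end Path

/-! ### Borel–Cantelli for the full-linearity events -/

/-- A conditional probability that is almost surely at least `c` bounds the probability below. -/
theorem le_measureReal_of_le_condProb {Ω : Type*} {m m0 : MeasurableSpace Ω} {P : Measure Ω}
    [IsProbabilityMeasure P] (hm : m ≤ m0) {s : Set Ω} (hs : MeasurableSet s) {c : ℝ}
    (h : ∀ᵐ v ∂P, c ≤ (P⟦s | m⟧) v) : c ≤ P.real s := by
  have h1 : ∫ v, (P⟦s | m⟧) v ∂P = P.real s := by
    rw [integral_condExp hm, integral_indicator_const _ hs, smul_eq_mul, mul_one]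
  rw [← h1]
  calc c = ∫ _, c ∂P := by simp
    _ ≤ _ := integral_mono_ae (integrable_const c) integrable_condExp h

theorem history_le {Ω : Type*} [m0 : MeasurableSpace Ω] {x : ℕ → Ω → Space n}
    (hx : ∀ k, Measurable (x k)) (k : ℕ) : history x k ≤ m0 :=
  iSup₂_le fun j _ => (hx j).comap_le

/-- If the probabilities approach one summably fast, then almost surely all models are eventually
fully linear. -/
theorem ProbFullyLinear.eventually_fullyLinear {Ω : Type*} [MeasurableSpace Ω] {P : Measure Ω}
    [IsProbabilityMeasure P] {N : Seminorm ℝ (Space n)} {cf cg : ℝ} {f : Fin q → Space n → ℝ}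
    {M : ℕ → Ω → Approx n q} {x : ℕ → Ω → Space n} {δ : ℕ → Ω → ℝ} {α : ℕ → ℝ}
    (h : ProbFullyLinear P N cf cg f M x δ α) (hx : ∀ k, Measurable (x k)) (hq : 0 < q)
    (hα : ∀ k, α k ∈ Set.Icc (0 : ℝ) 1) (hsum : Summable fun k => 1 - α k ^ q) :
    ∀ᵐ v ∂P, ∀ᶠ k in atTop, ∀ i, (M k v).FullyLinear N cf cg (f i) i (x k v) (δ k v) := by
  have hi : ∀ i, ∀ᵐ v ∂P, ∀ᶠ k in atTop, v ∉ (flEvent N cf cg f M x δ k i)ᶜ := fun i => by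
    refine ae_eventually_notMem (ne_top_of_le_ne_top hsum.tsum_ofReal_ne_top ?_)
    refine ENNReal.tsum_le_tsum fun k => ?_
    rw [← ofReal_measureReal, probReal_compl_eq_one_sub (h k i).1]
    refine ENNReal.ofReal_le_ofReal ?_
    have h1 := le_measureReal_of_le_condProb (history_le hx k) (h k i).1 (h k i).2
    have h2 : α k ^ q ≤ α k := pow_le_of_le_one (hα k).1 (hα k).2 hq.ne'
    linarith
  filter_upwards [ae_all_iff.2 hi] with v hv
  exact eventually_all.2 fun i => (hv i).mono fun k hk => not_not.1 hk

end SMOP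

theorem mainTheorem1 {n q : ℕ} (hq : 0 < q)
    -- an arbitrary norm on `ℝⁿ`
    (N : Seminorm ℝ (SMOP.Space n)) (hN : ∀ y, N y = 0 → y = 0)
    -- the objectives: twice continuously differentiable, bounded below, with bounded Hessians
    (f : Fin q → SMOP.Space n → ℝ)
    (hf : ∀ i, ContDiff ℝ 2 (f i)) (hfb : ∀ i, BddBelow (Set.range (f i)))
    (ch : ℝ) (hch : 0 < ch) (hess : ∀ i y, SMOP.inducedNorm N (SMOP.hessian (f i) y) ≤ ch)
    -- the parameters of the algorithm
    (x₀ : SMOP.Space n) (Θ δmax δ₀ γ₁ η₁ : ℝ) (hΘ : 0 < Θ) (hδmax : 0 < δmax)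
    (hδ₀ : δ₀ ∈ Set.Ioo 0 δmax) (hγ₁ : γ₁ ∈ Set.Ioo (0 : ℝ) 1) (hη₁ : η₁ ∈ Set.Ioo (0 : ℝ) 1)
    (α : ℕ → ℝ) (hα : ∀ k, α k ∈ Set.Icc (0 : ℝ) 1)
    -- the random quantities
    {Ω : Type*} [MeasurableSpace Ω] (P : Measure Ω) [IsProbabilityMeasure P]
    (M : ℕ → Ω → SMOP.Approx n q) (x d : ℕ → Ω → SMOP.Space n) (δ : ℕ → Ω → ℝ)
    (hx : ∀ k, Measurable (x k))
    -- almost every sample path is a run of the algorithm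
    (hrun : ∀ᵐ v ∂P, SMOP.IsRun N Θ δmax γ₁ η₁ x₀ δ₀
      (fun k => M k v) (fun k => x k v) (fun k => d k v) (fun k => δ k v))
    -- the models are probabilistically fully linear
    (cf cg : ℝ) (hcf : 0 ≤ cf) (hcg : 0 ≤ cg)
    (hPFL : SMOP.ProbFullyLinear P N cf cg f M x δ α)
    -- the Hessian approximations are bounded
    (cb : ℝ) (hcb : 0 < cb) (hbeta : ∀ᵐ v ∂P, ∀ k, (M k v).beta N ≤ cb)
    -- the approximate objectives and gradients
    (L ca : ℝ) (hL : 0 ≤ L) (hca : 0 < ca)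
    (happ : ∀ᵐ v ∂P, ∀ k i, ContDiff ℝ 1 ((M k v).fApp i) ∧
      (∀ y z, N (gradient ((M k v).fApp i) y - gradient ((M k v).fApp i) z) ≤ L * N (y - z)) ∧
      N (gradient ((M k v).fApp i) (x k v) - (M k v).g i) ≤ ca * δ k v)
    -- the probabilities approach one fast enough
    (hsum : Summable fun k => 1 - α k ^ q)
    -- the lower bound on `Θ`, with `c_e = c_f + L + c_g + c_a + c_h / 2`
    (hΘb : max cb (max (5 * cf) (4 * (cf + L + cg + ca + ch / 2) / η₁)) ≤ Θ)
    -- the iterates are bounded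
    (hbdd : ∀ᵐ v ∂P, ∃ R : ℝ, ∀ k, N (x k v) ≤ R) :
    (∀ᵐ v ∂P, Tendsto (fun k => SMOP.marginal N f (x k v)) atTop (𝓝 0)) ∧
    (∀ᵐ v ∂P, ∀ y, MapClusterPt y atTop (fun k => x k v) → SMOP.ParetoCritical f y) := by
  have hlim : ∀ᵐ v ∂P, Tendsto (fun k => SMOP.marginal N f (x k v)) atTop (𝓝 0) := by
    filter_upwards [hrun, hPFL.eventually_fullyLinear hx hq hα hsum, hbeta, happ]
      with v hv hfl hbv hav
    exact hv.tendsto_marginal hq hN hf hfb hch.le hess hΘ hδmax hδ₀.1 hγ₁ hη₁.2 hcg hcb.le hbv hL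
      hca.le hav ((le_max_left _ _).trans hΘb)
      ((le_max_left _ _).trans ((le_max_right _ _).trans hΘb)) hfl
  refine ⟨hlim, ?_⟩
  filter_upwards [hlim] with v hv y hy
  obtain ⟨a, ha, -, h2⟩ := SMOP.exists_norm_comparison N hN
  refine SMOP.paretoCritical_of_marginal_eq_zero hq ha h2 (N := N) ?_
  have hcont := SMOP.continuous_marginal hq hN hch.le hf hess
  have hcluster : MapClusterPt (SMOP.marginal N f y) atTop fun k => SMOP.marginal N f (x k v) :=
    MapClusterPt.tendsto_comp (f := SMOP.marginal N f) hcont.continuousAt hy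
  -- In a Hausdorff space a convergent sequence has no cluster point other than its limit.
  exact eq_of_nhds_neBot (NeBot.mono hcluster (inf_le_inf_left _ hv))
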